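/- Let $\|\cdot\|$ be an arbitrary norm on $\mathbb{R}^n$, let $\|v\|^*=\max_{\|u\|\le 1} u\cdot v$ be its dual norm, and let $\|\cdot\|_2$ be the Euclidean norm. For a polyhedron $Q\subseteq\mathbb{R}^n$ and a point $x$, the separation problem of $x$ from $Q$ is to maximize $\pi\cdot x-\pi_0$ over all $(\pi,\pi_0)\in\mathbb{R}^n\times\mathbb{R}$ with $\pi\cdot y\le\pi_0$ for all $y\in Q$, where $\pi$ is in addition subject to a normalization. Let $\check x\notin Q$ and $\hat x\in Q$, and let $[\check x,\hat x]$ be the closed segment between them. Consider the following method. Start with $x'=\check x$. While $x'\notin Q$: let $(\pi,\pi_0)$ be any optimal solution of the separation problem of $x'$ from $Q$ with the (secondary) normalization $\|\pi\|\le 1$, and replace $x'$ by the intersection point of $[\check x,\hat x]$ with the hyperplane $\pi\cdot x=\pi_0$. When $x'\in Q$, return the last cut $\pi\cdot x\le\pi_0$. The face generated in an iteration is $\{y\in Q:\pi\cdot y=\pi_0\}$. There is an angle $\theta_{\min}\in(0,\pi/2]$, depending only on the norm, such that for every $v\neq 0$ every subgradient of $\|\cdot\|^*$ at $v$ makes an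 angle of at most $\pi/2-\theta_{\min}$ with $v$, and such that the following holds for all $Q,\check x,\hat x$ as above. Let $d_{\min}$ be the Euclidean distance between $[\check x,\hat x]$ and the union of the faces of $Q$ that do not intersect $[\check x,\hat x]$ ($d_{\min}=\infty$ if there are none). 1. $d_{\min}>0$. 2. Every iteration is well defined: for $x'\in[\check x,\hat x]\setminus Q$ the separation problem with $\|\pi\|\le1$ has an optimal solution, and for each optimal solution the hyperplane $\pi\cdot x=\pi_0$ meets $[\check x,\hat x]$ in exactly one point. 3. In each iteration, with current point $x^{(i)}$ and next point $x^{(i+1)}$, the generated face is nonempty and $x^{(i+1)}$ lies on the segment from $x^{(i)}$ to $\hat x$. If the generated face intersects $[\check x,\hat x]$, then $x^{(i+1)}\in Q$ and the method stops. If it does not, then $\|x^{(i+1)}-x^{(i)}\|_2\ge d_{\min}\sin(\theta_{\min})>0$. 4. The method terminates after finitely many iterations, whichever optimal solutions are returned: the number of iterations is bounded for given $\|\cdot\|,Q,\check x,\hat x$, and after $k+1$ iterations one has $k\,d_{\min}\sin(\theta_{\min})\le\|\hat x-\check x\|_2$ (with $0\cdot\infty=0$). 5. The returned cut $\pi\cdot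 x\le\pi_0$ is valid for $Q$, is violated by $\check x$, and holds with equality at the final point $x'$, which lies on the frontier of $Q$ and is a point of $[\check x,\hat x]\cap Q$ closest to $\check x$. It is a cut associated with the directional normalization: for some $\alpha>0$, $(\alpha\pi,\alpha\pi_0)$ is an optimal solution of the separation problem of $\check x$ from $Q$ with the normalization $|(\hat x-\check x)\cdot\pi|\le 1$. -/

import Mathlib

open scoped ENNReal

noncomputable section

namespace FenchelSeparation

/-- The space `ℝⁿ` with its Euclidean structure. -/
abbrev Space (n : ℕ) : Type := EuclideanSpace ℝ (Fin n)

/-- A polyhedron: the solution set of finitely many linear inequalities. -/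
def IsPolyhedron {n : ℕ} (Q : Set (Space n)) : Prop :=
  ∃ (m : ℕ) (a : Fin m → Space n) (b : Fin m → ℝ), Q = {x | ∀ i, inner ℝ (a i) x ≤ b i}

/-- A linear inequality `π x ≤ π₀`, given by its coefficients. -/
structure Cut (n : ℕ) where
  /-- the vector `π` -/
  normal : Space n
  /-- the number `π₀` -/
  rhs : ℝ

namespace Cut

/-- `π x - π₀`, the violation of the cut by `x`. -/
def violation {n : ℕ} (C : Cut n) (x : Space n) : ℝ := inner ℝ C.normal x - C.rhs

/-- The cut is satisfied by all points of `Q`. -/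
def IsValid {n : ℕ} (C : Cut n) (Q : Set (Space n)) : Prop :=
  ∀ y ∈ Q, inner ℝ C.normal y ≤ C.rhs

/-- The hyperplane `π x = π₀`. -/
def hyperplane {n : ℕ} (C : Cut n) : Set (Space n) := {x | inner ℝ C.normal x = C.rhs}

/-- The points of `Q` that satisfy the cut with equality. -/
def face {n : ℕ} (C : Cut n) (Q : Set (Space n)) : Set (Space n) := Q ∩ C.hyperplane

/-- The cut `(α π) x ≤ α π₀`. -/
def scale {n : ℕ} (α : ℝ) (C : Cut n) : Cut n := ⟨α • C.normal, α * C.rhs⟩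

end Cut

/-- A face of `Q`: the set of points of `Q` at which some valid inequality is an equality. -/
def IsFace {n : ℕ} (Q F : Set (Space n)) : Prop := ∃ C : Cut n, C.IsValid Q ∧ F = C.face Q

/-- `C` is an optimal solution of the separation problem of `x` from `Q`:
maximize `π x - π₀` over the valid cuts whose normal `π` lies in the normalization set `S`. -/
def IsOptimalCut {n : ℕ} (S : Set (Space n)) (Q : Set (Space n)) (x : Space n) (C : Cut n) :
    Prop :=
  (C.IsValid Q ∧ C.normal ∈ S) ∧
    ∀ D : Cut n, D.IsValid Q → D.normal ∈ S → D.violation x ≤ C.violation x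

/-- The normalization `‖π‖ ≤ 1` for a norm `N`. -/
def normNormalization {n : ℕ} (N : Seminorm ℝ (Space n)) : Set (Space n) := {p | N p ≤ 1}

/-- The directional normalization `|(x̂ - x̌) π| ≤ 1`. -/
def directionalNormalization {n : ℕ} (xc xh : Space n) : Set (Space n) :=
  {p | |inner ℝ (xh - xc) p| ≤ 1}

/-- The cut `C` is associated with the directional normalization from `xc` toward `xh`: some
positive multiple of it (which describes the same half-space) is an optimal solution of the
separation problem of `xc` with that normalization. -/
def IsDirectionalCut {n : ℕ} (Q : Set (Space n)) (xc xh : Space n) (C : Cut n) : Prop :=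
  ∃ α : ℝ, 0 < α ∧ IsOptimalCut (directionalNormalization xc xh) Q xc (C.scale α)

/-- One iteration of the loop of the method at the current point `x`: `x` is not in `Q`, the
secondary separation problem returns the optimal cut `C`, and the next point `x'` is an
intersection point of the segment from `xc` to `xh` with the hyperplane of `C`. -/
def Step {n : ℕ} (N : Seminorm ℝ (Space n)) (Q : Set (Space n)) (xc xh : Space n)
    (x : Space n) (C : Cut n) (x' : Space n) : Prop :=
  x ∉ Q ∧ IsOptimalCut (normNormalization N) Q x C ∧ x' ∈ segment ℝ xc xh ∩ C.hyperplane

/-- The first `k` iterations of an execution of the method: `x i` is the current point at the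
beginning of iteration `i` and `C i` is the cut generated in iteration `i`, for `i < k`. -/
def IsRun {n : ℕ} (N : Seminorm ℝ (Space n)) (Q : Set (Space n)) (xc xh : Space n)
    (k : ℕ) (x : ℕ → Space n) (C : ℕ → Cut n) : Prop :=
  x 0 = xc ∧ ∀ i < k, Step N Q xc xh (x i) (C i) (x (i + 1))

/-- The dual norm `‖v‖* = max {u v : ‖u‖ ≤ 1}`. -/
def dualNorm {n : ℕ} (N : Seminorm ℝ (Space n)) (v : Space n) : ℝ :=
  sSup {r | ∃ u : Space n, N u ≤ 1 ∧ r = inner ℝ u v}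

/-- `g` is a subgradient of the function `f` at the point `v`. -/
def IsSubgradient {n : ℕ} (f : Space n → ℝ) (v g : Space n) : Prop :=
  ∀ w, f v + inner ℝ g (w - v) ≤ f w

/-- At every nonzero point, every subgradient of the dual norm makes with that point an angle
of at most `π / 2 - θ`. -/
def IsAngleBound {n : ℕ} (N : Seminorm ℝ (Space n)) (θ : ℝ) : Prop :=
  ∀ v g : Space n, v ≠ 0 → IsSubgradient (dualNorm N) v g →
    InnerProductGeometry.angle g v ≤ Real.pi / 2 - θ

/-- The Euclidean distance between the segment from `xc` to `xh` and the union of the faces of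
`Q` that do not intersect it (`∞` if that union is empty). -/
def dMin {n : ℕ} (Q : Set (Space n)) (xc xh : Space n) : ℝ≥0∞ :=
  ⨅ (F : Set (Space n)) (_ : IsFace Q F ∧ Disjoint F (segment ℝ xc xh))
    (y : Space n) (_ : y ∈ F) (x : Space n) (_ : x ∈ segment ℝ xc xh), edist x y

end FenchelSeparation

end

open FenchelSeparation

/-!
Let `A` and `B` be the constants in `N v ≤ A ‖v‖₂` and `‖v‖₂ ≤ B N v`. The angle is
`θ = arcsin (1 / (A B))`: a subgradient `g` of the dual norm at `v` satisfies `⟪g, v⟫ ≥ ‖v‖*`,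
hence `⟪g, v⟫ ≥ ‖v‖₂ / A`, while `‖g‖₂ ≤ B` (`isAngleBound_arcsin`).

The geometric input is the duality between separation and distance. If `y` is a point of `Q`
nearest to `x ∉ Q` in the dual norm, then a hyperplane separating `Q` from the open dual ball around
`x` that reaches to `y` gives a cut with normal of norm one and violation at least `‖x - y‖*`
(`exists_cut_violation_ge`). No cut does better, as `π x - π₀ ≤ π (x - y) ≤ ‖x - y‖*`, and equality
forces `π y = π₀`. So an optimal cut exists, and the generated face of every optimal cut contains
`y` (`exists_dual_point`).

If this face misses the segment, then `‖x - y‖₂ ≥ dMin`, so the violation at `x` is at least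
`dMin / A`. As `‖π‖₂ ≤ B`, the hyperplane is at distance at least `dMin / (A B) = dMin sin θ` from
`x` (`Step.dMin_mul_le_edist`). If the face meets the segment, it does so in the unique point of
the segment on the hyperplane, and the method stops. All steps go in the direction of `xh`, so their
lengths add up to at most the length of the segment (`IsRun.nat_mul_add_edist_le`); termination
follows because `dMin > 0`. That in turn holds because a polyhedron has only finitely many faces: a
nonempty face is determined by the constraints that are equalities on it (`face_eq_of_activeSet`).

The returned cut is tight at a point `xc + t (xh - xc)` of `Q`. Validity at this point bounds the
violation at `xc` of every cut in the directional normalization by `t`, and the returned cut attains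
this bound once it is scaled to `⟪xh - xc, π⟫ = -1` (`Cut.IsValid.isDirectionalCut`).
-/

namespace FenchelSeparation

open Set Filter Topology

variable {n : ℕ} {N : Seminorm ℝ (Space n)} {A B : ℝ} {Q : Set (Space n)}

/-! ### Norms on `ℝⁿ` and their dual norms -/

theorem seminorm_continuous (N : Seminorm ℝ (Space n)) : Continuous N :=
  continuousOn_univ.1 (N.convexOn.continuousOn isOpen_univ)

theorem exists_seminorm_le_mul_norm (N : Seminorm ℝ (Space n)) :
    ∃ A, 0 < A ∧ ∀ v, N v ≤ A * ‖v‖ :=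
  N.bound_of_continuous_normedSpace (seminorm_continuous N)

theorem exists_norm_le_mul_seminorm (hN : ∀ v, N v = 0 → v = 0) :
    ∃ B, 0 < B ∧ ∀ v, ‖v‖ ≤ B * N v := by
  rcases (Metric.sphere (0 : Space n) 1).eq_empty_or_nonempty with hs | hs
  · refine ⟨1, one_pos, fun v => ?_⟩
    have hv : v = 0 := by
      by_contra hv
      have : ‖v‖⁻¹ • v ∈ Metric.sphere (0 : Space n) 1 := by
        simp [norm_smul, inv_mul_cancel₀ (norm_ne_zero_iff.2 hv)]
      simp [hs] at this
    simp [hv]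
  · obtain ⟨u, hu, hmin⟩ := (isCompact_sphere (0 : Space n) 1).exists_isMinOn hs
      (seminorm_continuous N).continuousOn
    have hu0 : u ≠ 0 := by rintro rfl; simp at hu
    have hpos : 0 < N u := lt_of_le_of_ne (apply_nonneg N u) fun h => hu0 (hN u h.symm)
    refine ⟨(N u)⁻¹, inv_pos.2 hpos, fun v => ?_⟩
    rcases eq_or_ne v 0 with rfl | hv
    · simp
    have hv' : 0 < ‖v‖ := norm_pos_iff.2 hv
    have h1 : N u ≤ N (‖v‖⁻¹ • v) := hmin (by
      simp [norm_smul, inv_mul_cancel₀ hv'.ne'])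
    rw [map_smul_eq_mul, norm_inv, norm_norm] at h1
    rw [inv_mul_eq_div, le_div_iff₀ hpos]
    have := mul_le_mul_of_nonneg_left h1 hv'.le
    rwa [← mul_assoc, mul_inv_cancel₀ hv'.ne', one_mul] at this

theorem inner_le_mul_norm (hB : ∀ v, ‖v‖ ≤ B * N v) (hB0 : 0 < B) {u v : Space n} (hu : N u ≤ 1) :
    inner ℝ u v ≤ B * ‖v‖ := by
  refine (real_inner_le_norm u v).trans (mul_le_mul_of_nonneg_right ?_ (norm_nonneg v))
  exact (hB u).trans (by nlinarith)

theorem inner_le_dualNorm (hB : ∀ v, ‖v‖ ≤ B * N v) (hB0 : 0 < B) {u : Space n} (v : Space n)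
    (hu : N u ≤ 1) : inner ℝ u v ≤ dualNorm N v := by
  refine le_csSup ⟨B * ‖v‖, ?_⟩ ⟨u, hu, rfl⟩
  rintro r ⟨w, hw, rfl⟩
  exact inner_le_mul_norm hB hB0 hw

theorem dualNorm_le {v : Space n} {c : ℝ} (h : ∀ u, N u ≤ 1 → inner ℝ u v ≤ c) :
    dualNorm N v ≤ c := by
  refine csSup_le ⟨_, 0, by simp, rfl⟩ ?_
  rintro r ⟨w, hw, rfl⟩
  exact h w hw

/-- The Euclidean norm is bounded by a multiple of the dual norm. -/
theorem norm_le_mul_dualNorm (hA : ∀ v, N v ≤ A * ‖v‖) (hA0 : 0 < A)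
    (hB : ∀ v, ‖v‖ ≤ B * N v) (hB0 : 0 < B) (v : Space n) : ‖v‖ ≤ A * dualNorm N v := by
  rcases eq_or_ne v 0 with rfl | hv
  · have := inner_le_dualNorm hB hB0 (u := 0) (0 : Space n) (by simp)
    simp only [inner_zero_left] at this
    rw [norm_zero]; positivity
  have hv' : 0 < ‖v‖ := norm_pos_iff.2 hv
  -- the test vector is `v`, scaled so that its norm is at most one
  have h := inner_le_dualNorm hB hB0 (u := (A * ‖v‖)⁻¹ • v) v (by
    rw [map_smul_eq_mul, norm_inv, Real.norm_of_nonneg (by positivity), inv_mul_eq_div]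
    exact div_le_one_of_le₀ (hA v) (by positivity))
  rw [real_inner_smul_left, real_inner_self_eq_norm_sq] at h
  calc ‖v‖ = A * ((A * ‖v‖)⁻¹ * ‖v‖ ^ 2) := by field_simp
    _ ≤ _ := mul_le_mul_of_nonneg_left h hA0.le

/-- The dual norm, bundled as a seminorm. The bound `hB` makes the supremum in `dualNorm` one of a
set bounded above. -/
noncomputable def dualSeminorm (hB : ∀ v, ‖v‖ ≤ B * N v) (hB0 : 0 < B) : Seminorm ℝ (Space n) :=
  Seminorm.ofSMulLE (dualNorm N)
    (le_antisymm (dualNorm_le fun u _ => by simp)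
      (by simpa using inner_le_dualNorm hB hB0 (u := 0) (0 : Space n) (by simp)))
    (fun x y => dualNorm_le fun u hu => by
      rw [inner_add_right]
      exact add_le_add (inner_le_dualNorm hB hB0 x hu) (inner_le_dualNorm hB hB0 y hu))
    (fun r x => dualNorm_le fun u hu => by
      rw [real_inner_smul_right, Real.norm_eq_abs]
      refine (le_abs_self _).trans ?_
      rw [abs_mul]
      refine mul_le_mul_of_nonneg_left (abs_le'.2 ⟨inner_le_dualNorm hB hB0 x hu, ?_⟩)
        (abs_nonneg r)
      rw [← inner_neg_left]
      exact inner_le_dualNorm hB hB0 x (by rwa [map_neg_eq_map]))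

/-- Bipolarity: a vector `p` with `N p = 1` attains this norm on the unit ball of the dual norm. -/
theorem exists_dualNorm_le_one_inner_eq {p : Space n} (hp : N p = 1) :
    ∃ w, dualNorm N w ≤ 1 ∧ inner ℝ w p = 1 := by
  obtain ⟨f, hf⟩ := geometric_hahn_banach_open_point (N.convex_ball 0 1)
    (by rw [Seminorm.ball_zero_eq]; exact isOpen_lt (seminorm_continuous N) continuous_const)
    (x := p) (by simp [hp])
  have hfp : 0 < f p := by
    simpa using hf 0 (by simp)
  set q := (InnerProductSpace.toDual ℝ (Space n)).symm f
  have hfq : ∀ x, inner ℝ q x = f x := fun x => InnerProductSpace.toDual_symm_apply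
  refine ⟨(f p)⁻¹ • q, dualNorm_le fun u hu => ?_, ?_⟩
  · rw [real_inner_smul_right, real_inner_comm, hfq, inv_mul_le_iff₀ hfp, mul_one]
    -- otherwise a multiple of `u` in the open ball takes the value `f p`
    by_contra! hlt
    have hfu : 0 < f u := hfp.trans hlt
    have := hf ((f p / f u) • u) (by
      rw [Seminorm.mem_ball_zero, map_smul_eq_mul, Real.norm_of_nonneg (by positivity)]
      nlinarith [apply_nonneg N u, (div_lt_one hfu).2 hlt, div_pos hfp hfu])
    rw [map_smul, smul_eq_mul, div_mul_cancel₀ _ hfu.ne'] at this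
    exact this.false
  · rw [real_inner_smul_left, hfq, inv_mul_cancel₀ hfp.ne']

/-- The equivalence constants of the norm and the Euclidean norm bound the angle between a vector
and a subgradient of the dual norm: such a subgradient `g` at `v` satisfies
`⟪g, v⟫ = ‖v‖* ≥ ‖v‖₂ / A` and `‖g‖₂ ≤ B`. -/
theorem isAngleBound_arcsin (hA : ∀ v, N v ≤ A * ‖v‖) (hA0 : 0 < A)
    (hB : ∀ v, ‖v‖ ≤ B * N v) (hB0 : 0 < B) : IsAngleBound N (Real.arcsin (A * B)⁻¹) := by
  intro v g hv hg
  have h1 : dualNorm N v ≤ inner ℝ g v := by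
    have h0 := hg 0
    have h00 : dualNorm N (0 : Space n) = 0 := map_zero (dualSeminorm hB hB0)
    rw [h00, zero_sub, inner_neg_right] at h0
    linarith
  have h2 : ∀ w, inner ℝ g w ≤ dualNorm N w := by
    intro w
    have h := hg (v + w)
    have h' : dualNorm N (v + w) ≤ dualNorm N v + dualNorm N w :=
      map_add_le_add (dualSeminorm hB hB0) v w
    rw [add_sub_cancel_left] at h
    linarith
  have hv' : 0 < ‖v‖ := norm_pos_iff.2 hv
  have h3 := norm_le_mul_dualNorm hA hA0 hB hB0 v
  have h4 : ‖g‖ ≤ B := by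
    have h := (h2 g).trans (dualNorm_le fun u hu => inner_le_mul_norm hB hB0 hu)
    rw [real_inner_self_eq_norm_sq] at h
    by_contra! hc
    nlinarith [norm_nonneg g]
  have h5 : 0 < inner ℝ g v := by
    have : 0 < A * dualNorm N v := hv'.trans_le h3
    exact (pos_of_mul_pos_right this hA0.le).trans_le h1
  have hg' : 0 < ‖g‖ := norm_pos_iff.2 (by rintro rfl; simp at h5)
  rw [← Real.arccos_eq_pi_div_two_sub_arcsin]
  refine Real.antitone_arccos ?_
  rw [inv_le_iff_one_le_mul₀ (by positivity), ← mul_div_right_comm, le_div_iff₀ (by positivity)]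
  nlinarith [mul_le_mul_of_nonneg_left h1 hA0.le, mul_le_mul_of_nonneg_right h4 hv'.le]

/-! ### Duality between separation and distance -/

theorem exists_dualNorm_nearest (hA : ∀ v, N v ≤ A * ‖v‖) (hA0 : 0 < A)
    (hB : ∀ v, ‖v‖ ≤ B * N v) (hB0 : 0 < B) (hQ : IsClosed Q) (hne : Q.Nonempty) (x : Space n) :
    ∃ y ∈ Q, ∀ z ∈ Q, dualNorm N (x - y) ≤ dualNorm N (x - z) := by
  obtain ⟨y₀, hy₀⟩ := hne
  have hcont : Continuous fun y => dualNorm N (x - y) :=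
    (seminorm_continuous (dualSeminorm hB hB0)).comp (continuous_const.sub continuous_id)
  have hev : ∀ᶠ y in cocompact (Space n) ⊓ 𝓟 Q, dualNorm N (x - y₀) ≤ dualNorm N (x - y) := by
    refine Eventually.filter_mono inf_le_left ?_
    filter_upwards [(tendsto_norm_cocompact_atTop (E := Space n)).eventually_ge_atTop
      (A * dualNorm N (x - y₀) + ‖x‖)] with y hy
    have h1 := norm_le_mul_dualNorm hA hA0 hB hB0 (x - y)
    have h2 := norm_sub_norm_le y x
    rw [norm_sub_rev] at h2
    exact le_of_mul_le_mul_left (by linarith) hA0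
  obtain ⟨y, hy, hmin⟩ := hcont.continuousOn.exists_isMinOn' hQ hy₀ hev
  exact ⟨y, hy, fun z hz => hmin hz⟩

/-- Strong duality: the largest violation at `x` of a cut with normal of norm at most one is the
distance, in the dual norm, from `x` to `Q`. -/
theorem exists_cut_violation_ge (hA : ∀ v, N v ≤ A * ‖v‖) (hA0 : 0 < A)
    (hB : ∀ v, ‖v‖ ≤ B * N v) (hB0 : 0 < B) (hQ : Convex ℝ Q)
    {x y : Space n} (hx : x ∉ Q) (hy : y ∈ Q)
    (hmin : ∀ z ∈ Q, dualNorm N (x - y) ≤ dualNorm N (x - z)) :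
    ∃ C : Cut n, C.IsValid Q ∧ N C.normal ≤ 1 ∧ dualNorm N (x - y) ≤ C.violation x := by
  set δ := dualNorm N (x - y) with hδ
  have hδ0 : 0 < δ := by
    have h : 0 < ‖x - y‖ := norm_pos_iff.2 (sub_ne_zero.2 fun h => hx (h ▸ hy))
    exact pos_of_mul_pos_right (h.trans_le (norm_le_mul_dualNorm hA hA0 hB hB0 _)) hA0.le
  let D := dualSeminorm hB hB0
  have hball : D.ball x δ = {z | D (z - x) < δ} := rfl
  have hdisj : Disjoint (D.ball x δ) Q := by
    rw [Set.disjoint_left]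
    intro z hz hzQ
    rw [Seminorm.mem_ball, map_sub_rev] at hz
    exact (hmin z hzQ).not_gt hz
  have hopen : IsOpen (D.ball x δ) := by
    rw [hball]
    exact isOpen_lt ((seminorm_continuous D).comp (continuous_id.sub continuous_const))
      continuous_const
  obtain ⟨f, u, hf1, hf2⟩ := geometric_hahn_banach_open (D.convex_ball x δ) hopen hQ hdisj
  set q := (InnerProductSpace.toDual ℝ (Space n)).symm f
  have hfq : ∀ x, inner ℝ q x = f x := fun x => InnerProductSpace.toDual_symm_apply
  have hxu : f x < u := hf1 x (by simp [hδ0])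
  have hq0 : q ≠ 0 := by
    intro h0
    have h1 := hfq x
    have h2 := hfq y
    rw [h0, inner_zero_left] at h1 h2
    linarith [hf2 y hy]
  have hNq : 0 < N q := by
    have := (norm_pos_iff.2 hq0).trans_le (hB q)
    exact pos_of_mul_pos_right this hB0.le
  -- the normal points from `Q` towards `x` and is scaled to norm one
  set p := (-(N q)⁻¹) • q with hp
  have hNp : N p = 1 := by
    rw [hp, map_smul_eq_mul, norm_neg, Real.norm_of_nonneg (by positivity),
      inv_mul_cancel₀ hNq.ne']
  have hpi : ∀ z, inner ℝ p z = -(N q)⁻¹ * f z := fun z => by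
    rw [hp, real_inner_smul_left, hfq]
  have hinv : 0 < (N q)⁻¹ := inv_pos.2 hNq
  refine ⟨⟨p, -(N q)⁻¹ * u⟩, fun z hz => ?_, hNp.le, ?_⟩
  · change inner ℝ p z ≤ _
    rw [hpi]
    nlinarith [hf2 z hz]
  · change _ ≤ inner ℝ p x - -(N q)⁻¹ * u
    obtain ⟨w, hw, hwp⟩ := exists_dualNorm_le_one_inner_eq hNp
    -- the points `x - s w` with `s < δ` lie in the open ball
    refine le_of_forall_lt_imp_le_of_dense fun s hs => ?_
    rcases le_or_gt s 0 with hs0 | hs0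
    · rw [hpi]
      nlinarith
    have hmem : x - s • w ∈ D.ball x δ := by
      rw [Seminorm.mem_ball, sub_sub_cancel_left, map_neg_eq_map, map_smul_eq_mul,
        Real.norm_of_nonneg hs0.le]
      have : D w ≤ 1 := hw
      nlinarith
    have h1 := hf1 _ hmem
    have h2 := hpi (x - s • w)
    rw [inner_sub_right, real_inner_smul_right, real_inner_comm w p, hwp] at h2
    nlinarith

/-- Every point `x` outside `Q` has an associated point `y` of `Q`, nearest in the dual norm, that
lies on the face generated by each optimal cut and determines the optimal violation. -/
theorem exists_dual_point (hA : ∀ v, N v ≤ A * ‖v‖) (hA0 : 0 < A)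
    (hB : ∀ v, ‖v‖ ≤ B * N v) (hB0 : 0 < B) (hQ : Convex ℝ Q) (hQc : IsClosed Q)
    (hne : Q.Nonempty) {x : Space n} (hx : x ∉ Q) :
    (∃ C, IsOptimalCut (normNormalization N) Q x C) ∧
      ∃ y ∈ Q, ∀ C, IsOptimalCut (normNormalization N) Q x C →
        y ∈ C.face Q ∧ C.violation x = dualNorm N (x - y) := by
  obtain ⟨y, hy, hmin⟩ := exists_dualNorm_nearest hA hA0 hB hB0 hQc hne x
  obtain ⟨C₀, hC₀, hN₀, hv₀⟩ := exists_cut_violation_ge hA hA0 hB hB0 hQ hx hy hmin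
  have hweak : ∀ C : Cut n, C.IsValid Q → N C.normal ≤ 1 →
      C.violation x ≤ inner ℝ C.normal (x - y) ∧
        inner ℝ C.normal (x - y) ≤ dualNorm N (x - y) := by
    intro C hC hN
    refine ⟨?_, inner_le_dualNorm hB hB0 _ hN⟩
    rw [inner_sub_right, Cut.violation]
    linarith [hC y hy]
  refine ⟨⟨C₀, ⟨hC₀, hN₀⟩, fun D hD hDN => ?_⟩, y, hy, fun C hC => ?_⟩
  · exact ((hweak D hD hDN).1.trans (hweak D hD hDN).2).trans hv₀
  · obtain ⟨⟨hCv, hCN⟩, hopt⟩ := hC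
    have h1 := hopt C₀ hC₀ hN₀
    obtain ⟨h2, h3⟩ := hweak C hCv hCN
    refine ⟨⟨hy, ?_⟩, by linarith⟩
    rw [inner_sub_right] at h2 h3
    simp only [Cut.violation] at h1 h2 hv₀
    change inner ℝ C.normal y = C.rhs
    linarith

/-! ### Faces of a polyhedron -/

theorem IsPolyhedron.convex (hQ : IsPolyhedron Q) : Convex ℝ Q := by
  obtain ⟨m, a, b, rfl⟩ := hQ
  rw [ofPred_forall]
  exact convex_iInter fun i => convex_halfSpace_le (innerₛₗ ℝ (a i)).isLinear (b i)

theorem IsPolyhedron.isClosed (hQ : IsPolyhedron Q) : IsClosed Q := by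
  obtain ⟨m, a, b, rfl⟩ := hQ
  rw [ofPred_forall]
  exact isClosed_iInter fun i =>
    isClosed_le (continuous_const.inner continuous_id) continuous_const

theorem Cut.isClosed_face (C : Cut n) (hQ : IsClosed Q) : IsClosed (C.face Q) :=
  hQ.inter (isClosed_eq (continuous_const.inner continuous_id) continuous_const)

theorem Cut.convex_face (C : Cut n) (hQ : Convex ℝ Q) : Convex ℝ (C.face Q) :=
  hQ.inter (convex_hyperplane (innerₛₗ ℝ C.normal).isLinear C.rhs)

/-- A nonempty convex subset of a polyhedron has a point at which all constraints are strict,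
except those that are equalities on the whole subset. -/
theorem exists_mem_forall_inner_lt {m : ℕ} {a : Fin m → Space n} {b : Fin m → ℝ}
    {F : Set (Space n)} (hF : Convex ℝ F) (hne : F.Nonempty)
    (hle : ∀ y ∈ F, ∀ i, inner ℝ (a i) y ≤ b i) (s : Finset (Fin m)) :
    ∃ y ∈ F, ∀ i ∈ s, (∀ z ∈ F, inner ℝ (a i) z = b i) ∨ inner ℝ (a i) y < b i := by
  induction s using Finset.induction_on with
  | empty => exact ⟨hne.some, hne.some_mem, by simp⟩
  | insert j s _ ih =>
    obtain ⟨y, hy, hs⟩ := ih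
    by_cases hj : ∀ z ∈ F, inner ℝ (a j) z = b j
    · refine ⟨y, hy, fun i hi => ?_⟩
      rcases Finset.mem_insert.1 hi with rfl | hi
      · exact Or.inl hj
      · exact hs i hi
    push Not at hj
    obtain ⟨z, hz, hzj⟩ := hj
    refine ⟨(1 / 2 : ℝ) • y + (1 / 2 : ℝ) • z,
      hF hy hz (by norm_num) (by norm_num) (by norm_num), fun i hi => ?_⟩
    rw [inner_add_right, real_inner_smul_right, real_inner_smul_right]
    rcases Finset.mem_insert.1 hi with rfl | hi
    · right
      linarith [hle y hy i, lt_of_le_of_ne (hle z hz i) hzj]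
    · refine (hs i hi).imp_right fun h => ?_
      linarith [hle z hz i]

/-- A nonempty face of a polyhedron is cut out by the constraints that are equalities on it. -/
theorem face_eq_of_activeSet {m : ℕ} {a : Fin m → Space n} {b : Fin m → ℝ} {F : Set (Space n)}
    (hF : IsFace {x | ∀ i, inner ℝ (a i) x ≤ b i} F) (hne : F.Nonempty) :
    F = {x | ∀ i, inner ℝ (a i) x ≤ b i ∧
      ((∀ z ∈ F, inner ℝ (a i) z = b i) → inner ℝ (a i) x = b i)} := by
  set Q : Set (Space n) := {x | ∀ i, inner ℝ (a i) x ≤ b i} with hQdef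
  obtain ⟨C, hC, hFC⟩ := hF
  have hle : ∀ y ∈ F, ∀ i, inner ℝ (a i) y ≤ b i := fun y hy => by
    rw [hFC] at hy
    exact hy.1
  refine Subset.antisymm (fun x hx i => ⟨hle x hx i, fun h => h x hx⟩) fun x hx => ?_
  have hxQ : x ∈ Q := fun i => (hx i).1
  have hconv : Convex ℝ F := hFC ▸ C.convex_face (IsPolyhedron.convex ⟨m, a, b, rfl⟩)
  obtain ⟨y, hy, hstrict⟩ := exists_mem_forall_inner_lt hconv hne hle Finset.univ
  -- moving from the relative interior point `y` slightly away from `x` does not leave `Q`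
  have hev : ∀ᶠ ε in 𝓝[>] (0 : ℝ), ∀ i, inner ℝ (a i) (y + ε • (y - x)) ≤ b i := by
    rw [eventually_all]
    intro i
    rcases hstrict i (Finset.mem_univ i) with h | h
    · refine Eventually.of_forall fun ε => ?_
      rw [inner_add_right, real_inner_smul_right, inner_sub_right, h y hy, (hx i).2 h]
      simp
    · have hc : Continuous fun ε : ℝ => inner ℝ (a i) (y + ε • (y - x)) := by fun_prop
      have := hc.tendsto 0
      simp only [zero_smul, add_zero] at this
      exact ((this.eventually_lt_const h).filter_mono nhdsWithin_le_nhds).mono fun _ h => h.le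
  obtain ⟨ε, hε, hε0⟩ := (hev.and self_mem_nhdsWithin).exists
  have h1 := hC _ hε
  have hyC : inner ℝ C.normal y = C.rhs := by
    rw [hFC] at hy
    exact hy.2
  rw [inner_add_right, real_inner_smul_right, inner_sub_right, hyC] at h1
  rw [hFC]
  refine ⟨hxQ, le_antisymm (hC x hxQ) ?_⟩
  have : ε * (C.rhs - inner ℝ C.normal x) ≤ 0 := by linarith
  linarith [nonpos_of_mul_nonpos_right this hε0]

theorem IsPolyhedron.finite_setOf_isFace (hQ : IsPolyhedron Q) : {F | IsFace Q F}.Finite := by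
  obtain ⟨m, a, b, rfl⟩ := hQ
  refine ((finite_univ (α := Set (Fin m))).image (fun I => {x : Space n |
    ∀ i, inner ℝ (a i) x ≤ b i ∧ (i ∈ I → inner ℝ (a i) x = b i)}) |>.insert ∅).subset ?_
  intro F hF
  rcases F.eq_empty_or_nonempty with h | h
  · exact Or.inl h
  · exact Or.inr ⟨{i | ∀ z ∈ F, inner ℝ (a i) z = b i}, mem_univ _,
      (face_eq_of_activeSet hF h).symm⟩

theorem dMin_pos (hQ : IsPolyhedron Q) (xc xh : Space n) : 0 < dMin Q xc xh := by
  have hcomp : IsCompact (segment ℝ xc xh) := by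
    rw [segment_eq_image_lineMap]
    exact isCompact_Icc.image AffineMap.lineMap_continuous
  have hfin : {F | IsFace Q F ∧ Disjoint F (segment ℝ xc xh)}.Finite :=
    hQ.finite_setOf_isFace.subset fun F hF => hF.1
  have hpos : ∀ F, IsFace Q F ∧ Disjoint F (segment ℝ xc xh) →
      0 < ⨅ (y : Space n) (_ : y ∈ F) (x : Space n) (_ : x ∈ segment ℝ xc xh), edist x y := by
    rintro F ⟨⟨C, -, rfl⟩, hd⟩
    obtain ⟨r, hr, h⟩ := Metric.exists_pos_forall_lt_edist hcomp
      (C.isClosed_face hQ.isClosed) hd.symm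
    refine (ENNReal.coe_pos.2 hr).trans_le ?_
    exact le_iInf₂ fun y hy => le_iInf₂ fun x hx => (h x hx y hy).le
  have : dMin Q xc xh = ⨅ F ∈ {F | IsFace Q F ∧ Disjoint F (segment ℝ xc xh)},
      ⨅ (y : Space n) (_ : y ∈ F) (x : Space n) (_ : x ∈ segment ℝ xc xh), edist x y := rfl
  rw [this, ← sInf_image]
  rcases Set.eq_empty_or_nonempty {F | IsFace Q F ∧ Disjoint F (segment ℝ xc xh)} with he | hne
  · rw [he]
    simp
  · obtain ⟨F, hF, hEq⟩ := Set.Nonempty.csInf_mem (α := ℝ≥0∞) (hne.image _)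
      (hfin.image fun F => ⨅ (y : Space n) (_ : y ∈ F) (x : Space n)
        (_ : x ∈ segment ℝ xc xh), edist x y)
    rw [← hEq]
    exact hpos F hF

/-! ### Hyperplanes meeting a segment -/

theorem Cut.violation_lineMap (C : Cut n) (x y : Space n) (t : ℝ) :
    C.violation (AffineMap.lineMap x y t) = (1 - t) * C.violation x + t * C.violation y := by
  simp only [Cut.violation, AffineMap.lineMap_apply_module, inner_add_right,
    real_inner_smul_right]
  ring

theorem Cut.mem_hyperplane_iff (C : Cut n) (x : Space n) :
    x ∈ C.hyperplane ↔ C.violation x = 0 := sub_eq_zero.symm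

theorem Cut.IsValid.violation_nonpos {C : Cut n} (hC : C.IsValid Q) {y : Space n} (hy : y ∈ Q) :
    C.violation y ≤ 0 := sub_nonpos.2 (hC y hy)

theorem Cut.exists_mem_segment_hyperplane {C : Cut n} {x y : Space n} (hx : 0 < C.violation x)
    (hy : C.violation y ≤ 0) : ∃ z, z ∈ segment ℝ x y ∩ C.hyperplane := by
  have hpos : 0 < C.violation x - C.violation y := by linarith
  refine ⟨AffineMap.lineMap x y (C.violation x / (C.violation x - C.violation y)), ?_, ?_⟩
  · rw [segment_eq_image_lineMap]
    exact ⟨_, ⟨by positivity, (div_le_one hpos).2 (by linarith)⟩, rfl⟩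
  · rw [Cut.mem_hyperplane_iff, Cut.violation_lineMap]
    field_simp
    ring

theorem Cut.eq_of_mem_segment_hyperplane {C : Cut n} {x y z w : Space n}
    (hx : 0 < C.violation x) (hy : C.violation y ≤ 0) (hz : z ∈ segment ℝ x y ∩ C.hyperplane)
    (hw : w ∈ segment ℝ x y ∩ C.hyperplane) : z = w := by
  obtain ⟨hz, hz'⟩ := hz
  obtain ⟨hw, hw'⟩ := hw
  rw [segment_eq_image_lineMap] at hz hw
  obtain ⟨s, -, rfl⟩ := hz
  obtain ⟨t, -, rfl⟩ := hw
  rw [Cut.mem_hyperplane_iff, Cut.violation_lineMap] at hz' hw'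
  have h : (s - t) * (C.violation x - C.violation y) = 0 := by linarith
  rcases mul_eq_zero.1 h with h | h
  · rw [sub_eq_zero.1 h]
  · linarith

theorem Cut.violation_left_pos {C : Cut n} {x y z : Space n} (hz : z ∈ segment ℝ x y)
    (hz' : 0 < C.violation z) (hy : C.violation y ≤ 0) : 0 < C.violation x := by
  rw [segment_eq_image_lineMap] at hz
  obtain ⟨t, ⟨ht0, ht1⟩, rfl⟩ := hz
  rw [Cut.violation_lineMap] at hz'
  exact pos_of_mul_pos_right (a := 1 - t) (by nlinarith) (by linarith)

/-! ### One iteration -/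

theorem dMin_le_edist {xc xh x y : Space n} {F : Set (Space n)} (hF : IsFace Q F)
    (hd : Disjoint F (segment ℝ xc xh)) (hy : y ∈ F) (hx : x ∈ segment ℝ xc xh) :
    dMin Q xc xh ≤ edist x y :=
  iInf₂_le_of_le F ⟨hF, hd⟩ (iInf₂_le_of_le y hy (iInf₂_le x hx))

theorem IsOptimalCut.violation_pos (hA : ∀ v, N v ≤ A * ‖v‖) (hA0 : 0 < A)
    (hB : ∀ v, ‖v‖ ≤ B * N v) (hB0 : 0 < B) (hQ : IsPolyhedron Q) (hne : Q.Nonempty)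
    {x : Space n} (hx : x ∉ Q) {C : Cut n} (hC : IsOptimalCut (normNormalization N) Q x C) :
    0 < C.violation x := by
  obtain ⟨-, y, hy, h⟩ := exists_dual_point hA hA0 hB hB0 hQ.convex hQ.isClosed hne hx
  rw [(h C hC).2]
  have hxy : 0 < ‖x - y‖ := norm_pos_iff.2 (sub_ne_zero.2 fun h => hx (h ▸ hy))
  exact pos_of_mul_pos_right (hxy.trans_le (norm_le_mul_dualNorm hA hA0 hB hB0 _)) hA0.le

theorem Step.mem_segment (hA : ∀ v, N v ≤ A * ‖v‖) (hA0 : 0 < A)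
    (hB : ∀ v, ‖v‖ ≤ B * N v) (hB0 : 0 < B) (hQ : IsPolyhedron Q) {xc xh x x' : Space n}
    (hxh : xh ∈ Q) {C : Cut n} (h : Step N Q xc xh x C x') (hx : x ∈ segment ℝ xc xh) :
    x' ∈ segment ℝ x xh := by
  obtain ⟨hxQ, hC, hx'⟩ := h
  have hv := hC.violation_pos hA hA0 hB hB0 hQ ⟨xh, hxh⟩ hxQ
  have hvh := hC.1.1.violation_nonpos hxh
  obtain ⟨z, hz, hzC⟩ := Cut.exists_mem_segment_hyperplane hv hvh
  have hsub : segment ℝ x xh ⊆ segment ℝ xc xh :=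
    (convex_segment xc xh).segment_subset hx (right_mem_segment ℝ xc xh)
  rwa [Cut.eq_of_mem_segment_hyperplane (Cut.violation_left_pos hx hv hvh) hvh hx'
    ⟨hsub hz, hzC⟩]

theorem Step.mem_of_face_inter_nonempty (hA : ∀ v, N v ≤ A * ‖v‖) (hA0 : 0 < A)
    (hB : ∀ v, ‖v‖ ≤ B * N v) (hB0 : 0 < B) (hQ : IsPolyhedron Q) {xc xh x x' : Space n}
    (hxh : xh ∈ Q) {C : Cut n} (h : Step N Q xc xh x C x') (hx : x ∈ segment ℝ xc xh)
    (hne : (C.face Q ∩ segment ℝ xc xh).Nonempty) : x' ∈ Q := by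
  obtain ⟨hxQ, hC, hx'⟩ := h
  have hvh := hC.1.1.violation_nonpos hxh
  obtain ⟨z, ⟨hzQ, hzC⟩, hz⟩ := hne
  rwa [Cut.eq_of_mem_segment_hyperplane (Cut.violation_left_pos hx
    (hC.violation_pos hA hA0 hB hB0 hQ ⟨xh, hxh⟩ hxQ) hvh) hvh hx' ⟨hz, hzC⟩]

/-- The violation `v` of the cut at `x` is at most `B` times the distance from `x` to the
hyperplane, and `A * v` bounds the distance from `x` to a point of the generated face. -/
theorem Step.dMin_mul_le_edist (hA : ∀ v, N v ≤ A * ‖v‖) (hA0 : 0 < A)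
    (hB : ∀ v, ‖v‖ ≤ B * N v) (hB0 : 0 < B) (hQ : IsPolyhedron Q) {xc xh x x' : Space n}
    (hxh : xh ∈ Q) {C : Cut n} (h : Step N Q xc xh x C x') (hx : x ∈ segment ℝ xc xh)
    (hd : Disjoint (C.face Q) (segment ℝ xc xh)) :
    dMin Q xc xh * ENNReal.ofReal (A * B)⁻¹ ≤ edist x x' := by
  obtain ⟨hxQ, hC, hx'⟩ := h
  obtain ⟨-, y, hy, hdual⟩ :=
    exists_dual_point hA hA0 hB hB0 hQ.convex hQ.isClosed ⟨xh, hxh⟩ hxQ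
  obtain ⟨hyF, hv⟩ := hdual C hC
  have h1 := norm_le_mul_dualNorm hA hA0 hB hB0 (x - y)
  have h2 : C.violation x ≤ B * ‖x - x'‖ := by
    have : C.violation x = inner ℝ C.normal (x - x') := by
      rw [inner_sub_right, show inner ℝ C.normal x' = C.rhs from hx'.2, Cut.violation]
    rw [this]
    exact inner_le_mul_norm hB hB0 hC.1.2
  have h3 : ‖x - y‖ * (A * B)⁻¹ ≤ ‖x - x'‖ := by
    rw [mul_inv_le_iff₀ (by positivity)]
    rw [← hv] at h1
    nlinarith [mul_le_mul_of_nonneg_left h2 hA0.le]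
  calc dMin Q xc xh * ENNReal.ofReal (A * B)⁻¹
      ≤ edist x y * ENNReal.ofReal (A * B)⁻¹ :=
        mul_le_mul_left (dMin_le_edist ⟨C, hC.1.1, rfl⟩ hd hyF hx) _
    _ = ENNReal.ofReal (‖x - y‖ * (A * B)⁻¹) := by
        rw [edist_dist, dist_eq_norm, ENNReal.ofReal_mul (norm_nonneg _)]
    _ ≤ edist x x' := by
        rw [edist_dist, dist_eq_norm]
        exact ENNReal.ofReal_le_ofReal h3

/-! ### Executions of the method -/

theorem IsRun.mem_segment {xc xh : Space n} {k : ℕ} {x : ℕ → Space n} {C : ℕ → Cut n}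
    (h : IsRun N Q xc xh k x C) : ∀ i ≤ k, x i ∈ segment ℝ xc xh
  | 0, _ => h.1 ▸ left_mem_segment ℝ xc xh
  | i + 1, hi => (h.2 i hi).2.2.1

/-- If every step but the last has length at least `c`, there are at most `‖xh - xc‖ / c` of them,
because all steps go in the same direction along the segment. -/
theorem IsRun.nat_mul_add_edist_le {xc xh : Space n} {k : ℕ} {x : ℕ → Space n} {C : ℕ → Cut n}
    {c : ℝ≥0∞} (h : IsRun N Q xc xh k x C) (hseg : ∀ i < k, x (i + 1) ∈ segment ℝ (x i) xh)
    (hc : ∀ i, i + 1 < k → c ≤ edist (x i) (x (i + 1))) :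
    ∀ i < k, (i : ℝ≥0∞) * c + edist (x i) xh ≤ edist xc xh
  | 0, _ => by simp [h.1]
  | i + 1, hi => by
    have hik : i < k := (Nat.lt_succ_self i).trans hi
    have ih := h.nat_mul_add_edist_le hseg hc i hik
    have hadd : edist (x i) xh = edist (x i) (x (i + 1)) + edist (x (i + 1)) xh := by
      simp only [edist_dist]
      rw [← ENNReal.ofReal_add dist_nonneg dist_nonneg, dist_add_dist_of_mem_segment (hseg i hik)]
    rw [hadd] at ih
    refine le_trans ?_ ih
    push_cast
    rw [add_mul, one_mul, add_assoc]
    gcongr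
    exact hc i hi

/-- A bound on the number of iterations yields a run that ends in `Q`: a run of maximal length
cannot be continued. -/
theorem exists_isRun_mem {xc xh : Space n} (hxc : xc ∉ Q)
    (hstep : ∀ x ∈ segment ℝ xc xh, x ∉ Q → ∃ C x', Step N Q xc xh x C x')
    {K : ℕ} (hK : ∀ k x C, IsRun N Q xc xh k x C → k ≤ K) :
    ∃ k x C, IsRun N Q xc xh (k + 1) x C ∧ x (k + 1) ∈ Q := by
  classical
  obtain ⟨k, ⟨x, C, hrun⟩, hmax⟩ : ∃ k, (∃ x C, IsRun N Q xc xh k x C) ∧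
      ∀ x C, ¬ IsRun N Q xc xh (k + 1) x C := by
    by_contra! hcon
    have hall : ∀ k, ∃ x C, IsRun N Q xc xh k x C := by
      intro k
      induction k with
      | zero => exact ⟨fun _ => xc, fun _ => ⟨0, 0⟩, rfl, by simp⟩
      | succ k ih => exact hcon k ih
    obtain ⟨x, C, h⟩ := hall (K + 1)
    exact (hK _ _ _ h).not_gt (Nat.lt_succ_self K)
  have hxk : x k ∈ Q := by
    by_contra hxk
    obtain ⟨C', x', hs⟩ := hstep (x k) (hrun.mem_segment k le_rfl) hxk
    refine hmax (Function.update x (k + 1) x') (Function.update C k C') ⟨?_, fun i hi => ?_⟩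
    · rw [Function.update_of_ne (by omega)]
      exact hrun.1
    · rcases Nat.lt_succ_iff_lt_or_eq.1 hi with hi | rfl
      · rw [Function.update_of_ne (by omega), Function.update_of_ne (by omega),
          Function.update_of_ne (by omega)]
        exact hrun.2 i hi
      · rw [Function.update_of_ne (by omega), Function.update_self, Function.update_self]
        exact hs
  cases k with
  | zero => exact absurd (hrun.1 ▸ hxk) hxc
  | succ k => exact ⟨k, x, C, hrun, hxk⟩

/-! ### The returned cut -/

/-- A point of `Q` on the hyperplane of a valid cut is a frontier point of `Q` when some point
violates the cut. -/
theorem Cut.IsValid.mem_frontier {C : Cut n} (hC : C.IsValid Q) {xc x : Space n}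
    (hxc : 0 < C.violation xc) (hx : x ∈ Q) (hxC : x ∈ C.hyperplane) : x ∈ frontier Q := by
  refine ⟨subset_closure hx, fun hint => ?_⟩
  have hc : Continuous fun t : ℝ => AffineMap.lineMap x xc t := AffineMap.lineMap_continuous
  have h0 : Tendsto (fun t : ℝ => AffineMap.lineMap x xc t) (𝓝[>] 0) (𝓝 x) := by
    have := hc.tendsto 0
    rw [AffineMap.lineMap_apply_zero] at this
    exact this.mono_left nhdsWithin_le_nhds
  obtain ⟨t, htQ, ht⟩ :=
    ((h0.eventually (mem_interior_iff_mem_nhds.1 hint)).and self_mem_nhdsWithin).exists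
  have h1 := hC.violation_nonpos htQ
  rw [Cut.violation_lineMap, (C.mem_hyperplane_iff x).1 hxC, mul_zero, zero_add] at h1
  exact (mul_pos ht hxc).not_ge h1

theorem Cut.IsValid.dist_le {C : Cut n} (hC : C.IsValid Q) {xc xh x y : Space n}
    (hxc : 0 < C.violation xc) (hxh : xh ∈ Q) (hx : x ∈ segment ℝ xc xh ∩ C.hyperplane)
    (hy : y ∈ segment ℝ xc xh ∩ Q) : dist xc x ≤ dist xc y := by
  obtain ⟨hx, hx'⟩ := hx
  obtain ⟨hy, hyQ⟩ := hy
  have hvh := hC.violation_nonpos hxh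
  have hvy := hC.violation_nonpos hyQ
  rw [segment_eq_image_lineMap] at hx hy
  obtain ⟨s, ⟨hs0, -⟩, rfl⟩ := hx
  obtain ⟨t, ⟨ht0, -⟩, rfl⟩ := hy
  rw [Cut.mem_hyperplane_iff, Cut.violation_lineMap] at hx'
  rw [Cut.violation_lineMap] at hvy
  rw [dist_left_lineMap, dist_left_lineMap, Real.norm_of_nonneg hs0, Real.norm_of_nonneg ht0]
  refine mul_le_mul_of_nonneg_right ?_ dist_nonneg
  by_contra! hlt
  nlinarith

/-- With `x = xc + t (xh - xc)` in `Q`, a valid cut `D` satisfies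
`D.violation xc ≤ -t * ⟪D.normal, xh - xc⟫ ≤ t` under the directional normalization, and a suitable
multiple of a valid cut that is tight at `x` attains this bound. -/
theorem Cut.IsValid.isDirectionalCut {C : Cut n} (hC : C.IsValid Q) {xc xh x : Space n}
    (hxc : 0 < C.violation xc) (hx : x ∈ segment ℝ xc xh) (hxQ : x ∈ Q)
    (hxC : x ∈ C.hyperplane) : IsDirectionalCut Q xc xh C := by
  rw [segment_eq_image_lineMap] at hx
  obtain ⟨t, ⟨ht0, -⟩, rfl⟩ := hx
  have hvio : ∀ D : Cut n, D.violation (AffineMap.lineMap xc xh t) =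
      D.violation xc + t * inner ℝ (xh - xc) D.normal := by
    intro D
    rw [Cut.violation_lineMap, real_inner_comm, inner_sub_right, Cut.violation, Cut.violation]
    ring
  have hCx := hvio C
  rw [(C.mem_hyperplane_iff _).1 hxC] at hCx
  set r := inner ℝ (xh - xc) C.normal with hr
  have hr0 : 0 < -r := by
    refine pos_of_mul_pos_right (a := t) ?_ ht0
    linarith
  have hscale : inner ℝ (xh - xc) (C.scale (-r)⁻¹).normal = -1 := by
    rw [Cut.scale, real_inner_smul_right, ← hr, inv_neg, neg_mul,
      inv_mul_cancel₀ (neg_pos.1 hr0).ne]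
  refine ⟨(-r)⁻¹, inv_pos.2 hr0, ⟨fun y hy => ?_, ?_⟩, fun D hD hDS => ?_⟩
  · rw [Cut.scale, real_inner_smul_left]
    exact mul_le_mul_of_nonneg_left (hC y hy) (inv_pos.2 hr0).le
  · change |inner ℝ (xh - xc) (C.scale (-r)⁻¹).normal| ≤ 1
    rw [hscale]
    norm_num
  · have h1 := hD.violation_nonpos hxQ
    rw [hvio] at h1
    have h2 : -1 ≤ inner ℝ (xh - xc) D.normal := (abs_le.1 hDS).1
    have h3 : (C.scale (-r)⁻¹).violation xc = t := by
      have : (C.scale (-r)⁻¹).violation xc = (-r)⁻¹ * C.violation xc := by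
        rw [Cut.violation, Cut.scale, real_inner_smul_left, Cut.violation, mul_sub]
      rw [this, inv_mul_eq_div, div_eq_iff hr0.ne']
      linarith
    rw [h3]
    nlinarith

end FenchelSeparation

open FenchelSeparation
theorem mainTheorem3 {n : ℕ} (N : Seminorm ℝ (Space n)) (hN : ∀ v, N v = 0 → v = 0) :
    -- the angle depends on the norm only
    ∃ θ : ℝ, 0 < θ ∧ θ ≤ Real.pi / 2 ∧ IsAngleBound N θ ∧
      ∀ Q : Set (Space n), IsPolyhedron Q → ∀ xc xh : Space n, xc ∉ Q → xh ∈ Q →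
        0 < dMin Q xc xh ∧
        -- every iteration can be carried out, whichever optimal cut is returned
        (∀ x ∈ segment ℝ xc xh, x ∉ Q →
          (∃ C, IsOptimalCut (normNormalization N) Q x C) ∧
          ∀ C, IsOptimalCut (normNormalization N) Q x C →
            ∃! x', x' ∈ segment ℝ xc xh ∩ C.hyperplane) ∧
        -- progress in each iteration
        (∀ k x C, IsRun N Q xc xh k x C → ∀ i < k,
          ((C i).face Q).Nonempty ∧
          x (i + 1) ∈ segment ℝ (x i) xh ∧
          (((C i).face Q ∩ segment ℝ xc xh).Nonempty → x (i + 1) ∈ Q) ∧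
          (Disjoint ((C i).face Q) (segment ℝ xc xh) →
            dMin Q xc xh * ENNReal.ofReal (Real.sin θ) ≤ edist (x i) (x (i + 1)))) ∧
        -- bound on the number of iterations
        (∀ k x C, IsRun N Q xc xh (k + 1) x C →
          (k : ℝ≥0∞) * (dMin Q xc xh * ENNReal.ofReal (Real.sin θ)) ≤ edist xc xh) ∧
        -- finite termination
        (∃ K : ℕ, ∀ k x C, IsRun N Q xc xh k x C → k ≤ K) ∧
        (∃ k x C, IsRun N Q xc xh (k + 1) x C ∧ x (k + 1) ∈ Q) ∧
        -- the returned cut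
        (∀ k x C, IsRun N Q xc xh (k + 1) x C → x (k + 1) ∈ Q →
          (C k).IsValid Q ∧ 0 < (C k).violation xc ∧
          x (k + 1) ∈ segment ℝ xc xh ∩ frontier Q ∩ (C k).hyperplane ∧
          (∀ y ∈ segment ℝ xc xh ∩ Q, dist xc (x (k + 1)) ≤ dist xc y) ∧
          IsDirectionalCut Q xc xh (C k)) := by
  obtain ⟨A₀, -, hA₀⟩ := exists_seminorm_le_mul_norm N
  obtain ⟨B₀, -, hB₀⟩ := exists_norm_le_mul_seminorm hN
  -- the constants are enlarged to at least one, so that `(A * B)⁻¹` is the sine of an angle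
  obtain ⟨A, hA1, hA⟩ : ∃ A, 1 ≤ A ∧ ∀ v, N v ≤ A * ‖v‖ := ⟨max A₀ 1, le_max_right _ _, fun v =>
    (hA₀ v).trans (mul_le_mul_of_nonneg_right (le_max_left _ _) (norm_nonneg v))⟩
  obtain ⟨B, hB1, hB⟩ : ∃ B, 1 ≤ B ∧ ∀ v, ‖v‖ ≤ B * N v := ⟨max B₀ 1, le_max_right _ _, fun v =>
    (hB₀ v).trans (mul_le_mul_of_nonneg_right (le_max_left _ _) (apply_nonneg N v))⟩
  have hA0 : 0 < A := by linarith
  have hB0 : 0 < B := by linarith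
  have hs0 : 0 < (A * B)⁻¹ := by positivity
  have hs1 : (A * B)⁻¹ ≤ 1 := inv_le_one_of_one_le₀ (one_le_mul_of_one_le_of_one_le hA1 hB1)
  have hsin : Real.sin (Real.arcsin (A * B)⁻¹) = (A * B)⁻¹ :=
    Real.sin_arcsin (by linarith) hs1
  refine ⟨Real.arcsin (A * B)⁻¹, Real.arcsin_pos.2 hs0, Real.arcsin_le_pi_div_two _,
    isAngleBound_arcsin hA hA0 hB hB0, ?_⟩
  rw [hsin]
  intro Q hQ xc xh hxc hxh
  have hd := dMin_pos hQ xc xh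
  have hcut : ∀ x ∈ segment ℝ xc xh, x ∉ Q →
      (∃ C, IsOptimalCut (normNormalization N) Q x C) ∧
        ∀ C, IsOptimalCut (normNormalization N) Q x C →
          ∃! x', x' ∈ segment ℝ xc xh ∩ C.hyperplane := by
    intro x hx hxQ
    refine ⟨(exists_dual_point hA hA0 hB hB0 hQ.convex hQ.isClosed ⟨xh, hxh⟩ hxQ).1,
      fun C hC => ?_⟩
    have hvh := hC.1.1.violation_nonpos hxh
    have hvc := Cut.violation_left_pos hx
      (hC.violation_pos hA hA0 hB hB0 hQ ⟨xh, hxh⟩ hxQ) hvh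
    obtain ⟨z, hz⟩ := Cut.exists_mem_segment_hyperplane hvc hvh
    exact ⟨z, hz, fun w hw => Cut.eq_of_mem_segment_hyperplane hvc hvh hw hz⟩
  have hprog : ∀ k x C, IsRun N Q xc xh k x C → ∀ i < k,
      ((C i).face Q).Nonempty ∧
      x (i + 1) ∈ segment ℝ (x i) xh ∧
      (((C i).face Q ∩ segment ℝ xc xh).Nonempty → x (i + 1) ∈ Q) ∧
      (Disjoint ((C i).face Q) (segment ℝ xc xh) →
        dMin Q xc xh * ENNReal.ofReal (A * B)⁻¹ ≤ edist (x i) (x (i + 1))) := by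
    intro k x C hrun i hi
    have hstep := hrun.2 i hi
    have hx := hrun.mem_segment i hi.le
    obtain ⟨-, y, -, hy⟩ :=
      exists_dual_point hA hA0 hB hB0 hQ.convex hQ.isClosed ⟨xh, hxh⟩ hstep.1
    exact ⟨⟨y, (hy _ hstep.2.1).1⟩, hstep.mem_segment hA hA0 hB hB0 hQ hxh hx,
      hstep.mem_of_face_inter_nonempty hA hA0 hB hB0 hQ hxh hx,
      hstep.dMin_mul_le_edist hA hA0 hB hB0 hQ hxh hx⟩
  have hbound : ∀ k x C, IsRun N Q xc xh (k + 1) x C →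
      (k : ℝ≥0∞) * (dMin Q xc xh * ENNReal.ofReal (A * B)⁻¹) ≤ edist xc xh := by
    intro k x C hrun
    refine le_self_add.trans (hrun.nat_mul_add_edist_le
      (fun i hi => (hprog _ x C hrun i hi).2.1) (fun i hi => ?_) k (Nat.lt_succ_self k))
    -- iteration `i` is not the last one, so the next point is outside `Q`
    have hi' : i < k + 1 := (Nat.lt_succ_self i).trans hi
    obtain ⟨-, -, hmem, hlen⟩ := hprog _ x C hrun i hi'
    exact hlen (Set.disjoint_iff_inter_eq_empty.2 (Set.not_nonempty_iff_eq_empty.1 fun hne =>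
      (hrun.2 (i + 1) hi).1 (hmem hne)))
  have hfin : ∃ K : ℕ, ∀ k x C, IsRun N Q xc xh k x C → k ≤ K := by
    have hc : dMin Q xc xh * ENNReal.ofReal (A * B)⁻¹ ≠ 0 :=
      mul_ne_zero hd.ne' (ENNReal.ofReal_pos.2 hs0).ne'
    obtain ⟨K, hK⟩ := ENNReal.exists_nat_mul_gt hc (edist_ne_top xc xh)
    refine ⟨K, fun k x C hrun => ?_⟩
    cases k with
    | zero => exact Nat.zero_le K
    | succ k =>
      by_contra! hlt
      refine (hK.trans_le (le_trans ?_ (hbound k x C hrun))).false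
      gcongr
      exact Nat.lt_succ_iff.1 hlt
  refine ⟨hd, hcut, hprog, hbound, hfin, ?_, ?_⟩
  · obtain ⟨K, hK⟩ := hfin
    refine exists_isRun_mem hxc (fun x hx hxQ => ?_) hK
    obtain ⟨⟨C, hC⟩, hC'⟩ := hcut x hx hxQ
    obtain ⟨x', hx', -⟩ := hC' C hC
    exact ⟨C, x', hxQ, hC, hx'⟩
  · intro k x C hrun hlast
    obtain ⟨hxQ, hC, hx', hxC⟩ := hrun.2 k (Nat.lt_succ_self k)
    have hvc := Cut.violation_left_pos (hrun.mem_segment k (Nat.le_succ k))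
      (hC.violation_pos hA hA0 hB hB0 hQ ⟨xh, hxh⟩ hxQ) (hC.1.1.violation_nonpos hxh)
    exact ⟨hC.1.1, hvc, ⟨⟨hx', hC.1.1.mem_frontier hvc hlast hxC⟩, hxC⟩,
      fun y hy => hC.1.1.dist_le hvc hxh ⟨hx', hxC⟩ hy,
      hC.1.1.isDirectionalCut hvc hx' hlast hxC⟩
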